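/- Let $c_1 = 2$ and $c_2 = (\log 3 - 1)/40 > 0$. These are universal constants with the following property. Let $m > 1$ be real, let $d \ge 2$ be an integer, and let $p$ be a probability distribution on $\{0,1,\dots,d\}$ with mean $m$. Let $(\xi_{n,i})_{n\ge 0,\, i\ge 1}$ be independent random variables with distribution $p$, and let $(Z_n)_{n\ge 0}$ be the Galton–Watson process defined by $Z_0 = 1$ and $Z_{n+1} = \sum_{i=1}^{Z_n} \xi_{n,i}$. Put $W_n = Z_n/m^n$ for $n \in \mathbb{N} = \{0,1,2,\dots\}$. Then $W_n$ converges almost surely to a finite limit $W_\infty$, and for every $n \in \mathbb{N}\cup\{\infty\}$ and every real $x \ge 0$, $$\mathbb{P}(W_n \ge x) \le c_1 \exp\left(-c_2\, \frac{m-1}{m}\, \frac{x}{d}\right).$$ -/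

import Mathlib

open MeasureTheory ProbabilityTheory Filter Topology

/-- The Galton–Watson process driven by the array `ξ`, where `ξ n i` is the number of children
of the `i`-th individual (counted from `0`) of generation `n`. -/
def gwSize {Ω : Type*} (ξ : ℕ → ℕ → Ω → ℕ) : ℕ → Ω → ℕ
  | 0, _ => 1
  | n + 1, ω => ∑ i ∈ Finset.range (gwSize ξ n ω), ξ n i ω

/-- The normalized process `W n = Z n / m ^ n` for finite `n`, and `W ∞ = lim W n`
(an arbitrary value where the limit does not exist). -/
noncomputable def gwNormalized {Ω : Type*} (m : ℝ) (ξ : ℕ → ℕ → Ω → ℕ) : ℕ∞ → Ω → ℝ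
  | ⊤, ω => limUnder atTop (fun n : ℕ => (gwSize ξ n ω : ℝ) / m ^ n)
  | (n : ℕ), ω => (gwSize ξ n ω : ℝ) / m ^ n

theorem gwNormalized_top {Ω : Type*} (m : ℝ) (ξ : ℕ → ℕ → Ω → ℕ) (ω : Ω) :
    gwNormalized m ξ ⊤ ω = limUnder atTop (fun n : ℕ => (gwSize ξ n ω : ℝ) / m ^ n) := rfl

theorem gwNormalized_coe {Ω : Type*} (m : ℝ) (ξ : ℕ → ℕ → Ω → ℕ) (n : ℕ) (ω : Ω) :
    gwNormalized m ξ (n : ℕ∞) ω = (gwSize ξ n ω : ℝ) / m ^ n := rfl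

/-! The tail bound is Markov's inequality for `exp (s W)`, so the point is an exponential moment of
`W n` bounded uniformly in `n`. For `t d ≤ 1` an offspring variable has moment generating function
at most `exp (m t (1 + d t))`, so passing from generation `n + 1` to `n` replaces `t` by `m t (1 + d
t)`. With `A = d / (m - 1)`, the change of variable `t = r / (1 - A r)` turns multiplication of `r`
by `m` into `t ↦ m t / (1 - d t)`, which dominates this step (`mobius_step_le`). Starting from `r =
s / m ^ n`, the iteration ends at `s / (1 - A s) ≤ 2 s`, whatever `n` is.

Convergence comes from variances: the squared increments of `W` have expectation of order `m ^
(-n)`, hence remain summable against the weight `√m ^ n`. Fatou's lemma carries the exponential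
moment to `W ∞`. -/

/-! ### Conditioning on the size of a generation -/

theorem measurable_gwSize {Ω : Type*} [MeasurableSpace Ω] {ξ : ℕ → ℕ → Ω → ℕ} (n : ℕ)
    (hξ : ∀ k < n, ∀ i, Measurable (ξ k i)) : Measurable (gwSize ξ n) := by
  induction n with
  | zero => exact measurable_const
  | succ n ih =>
    have hsum : Measurable fun a : ℕ × Ω => ∑ i ∈ Finset.range a.1, ξ n i a.2 :=
      measurable_from_prod_countable_right fun k =>
        Finset.measurable_fun_sum (Finset.range k) fun i _ => hξ n n.lt_succ_self i
    exact hsum.comp ((ih fun k hk => hξ k (hk.trans n.lt_succ_self)).prodMk measurable_id)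

theorem indepFun_gwSize_sum {Ω : Type*} [MeasurableSpace Ω] {μ : Measure Ω}
    {ξ : ℕ → ℕ → Ω → ℕ} (hξ : ∀ n i, Measurable (ξ n i))
    (hind : iIndepFun (fun q : ℕ × ℕ => ξ q.1 q.2) μ) (n k : ℕ) :
    IndepFun (gwSize ξ n) (fun ω => ∑ i ∈ Finset.range k, ξ n i ω) μ := by
  have hdisj : Disjoint {q : ℕ × ℕ | q.1 < n} {q : ℕ × ℕ | q.1 = n} :=
    Set.disjoint_left.2 fun q hq hq' => hq.ne hq'
  have h := indep_iSup_of_disjoint (fun q : ℕ × ℕ => (hξ q.1 q.2).comap_le) hind.iIndep hdisj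
  refine indep_of_indep_of_le_left (indep_of_indep_of_le_right h ?_) ?_
  · rw [← measurable_iff_comap_le]
    refine Finset.measurable_fun_sum _ fun i _ => ?_
    exact measurable_iff_comap_le.2 (le_iSup₂_of_le (n, i) rfl le_rfl)
  · rw [← measurable_iff_comap_le]
    -- The σ-algebra here is the one generated by the generations before `n`, which alone determine
    -- `gwSize ξ n`.
    refine @measurable_gwSize Ω (_) ξ n fun k hk i => ?_
    exact measurable_iff_comap_le.2 (le_iSup₂_of_le (k, i) hk le_rfl)

/-- One-step comparison: a bound for the sums of `k` offspring numbers, for every `k`, integrates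
to a bound for the pair of consecutive generation sizes. -/
theorem lintegral_gwSize_succ_le {Ω : Type*} [MeasurableSpace Ω] {μ : Measure Ω}
    {ξ : ℕ → ℕ → Ω → ℕ} (hξ : ∀ n i, Measurable (ξ n i))
    (hind : iIndepFun (fun q : ℕ × ℕ => ξ q.1 q.2) μ) (n : ℕ) (H : ℕ → ℕ → ENNReal)
    (K : ℕ → ENNReal)
    (hHK : ∀ k, ∫⁻ ω, H k (∑ i ∈ Finset.range k, ξ n i ω) ∂μ ≤ K k) :
    ∫⁻ ω, H (gwSize ξ n ω) (gwSize ξ (n + 1) ω) ∂μ ≤ ∫⁻ ω, K (gwSize ξ n ω) ∂μ := by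
  have hZ : Measurable (gwSize ξ n) := measurable_gwSize n fun k _ => hξ k
  have hS : ∀ k, Measurable fun ω => ∑ i ∈ Finset.range k, ξ n i ω := fun k =>
    Finset.measurable_fun_sum _ fun i _ => hξ n i
  have hI : ∀ k, Measurable fun ω => ({k} : Set ℕ).indicator (1 : ℕ → ENNReal) (gwSize ξ n ω) :=
    fun k => (measurable_from_nat (f := ({k} : Set ℕ).indicator (1 : ℕ → ENNReal))).comp hZ
  -- Splitting over the values of `gwSize ξ n` replaces the random number of summands by a fixed
  -- `k`, where independence applies.
  have hexp : ∀ F : ℕ → Ω → ENNReal, (∀ k, Measurable (F k)) →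
      ∫⁻ ω, F (gwSize ξ n ω) ω ∂μ =
        ∑' k, ∫⁻ ω, ({k} : Set ℕ).indicator 1 (gwSize ξ n ω) * F k ω ∂μ := by
    intro F hF
    rw [← lintegral_tsum fun k => (show Measurable fun ω =>
      ({k} : Set ℕ).indicator (1 : ℕ → ENNReal) (gwSize ξ n ω) * F k ω from
        (hI k).mul (hF k)).aemeasurable]
    refine lintegral_congr fun ω => ?_
    rw [tsum_eq_single (gwSize ξ n ω)]
    · simp
    · intro k hk
      simp [hk.symm]
  rw [hexp (fun k _ => K k) fun _ => measurable_const]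
  have hH : ∀ k, Measurable fun ω => H k (∑ i ∈ Finset.range k, ξ n i ω) := fun k =>
    measurable_from_nat.comp (hS k)
  have h1 := hexp (fun k ω => H k (∑ i ∈ Finset.range k, ξ n i ω)) hH
  refine h1.trans_le (ENNReal.tsum_le_tsum fun k => ?_)
  rw [lintegral_mul_const _ (hI k)]
  have h2 : IndepFun (fun ω => ({k} : Set ℕ).indicator (1 : ℕ → ENNReal) (gwSize ξ n ω))
      (fun ω => H k (∑ i ∈ Finset.range k, ξ n i ω)) μ :=
    (indepFun_gwSize_sum hξ hind n k).comp
      (measurable_from_nat (f := ({k} : Set ℕ).indicator (1 : ℕ → ENNReal)))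
      (measurable_from_nat (f := H k))
  rw [lintegral_mul_eq_lintegral_mul_lintegral_of_indepFun''
    (hI k).aemeasurable (hH k).aemeasurable h2]
  gcongr
  exact hHK k

/-! ### Exponential moments -/

theorem memLp_natCast_of_ae_le {Ω : Type*} [MeasurableSpace Ω] {μ : Measure Ω} [IsFiniteMeasure μ]
    {X : Ω → ℕ} {d : ℕ} (hX : Measurable X) (hd : ∀ᵐ ω ∂μ, X ω ≤ d) (q : ENNReal) :
    MemLp (fun ω => (X ω : ℝ)) q μ := by
  refine MemLp.of_bound (measurable_from_nat.comp hX).aestronglyMeasurable d ?_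
  filter_upwards [hd] with ω hω
  simpa using hω

/-- Moment generating function bound for a random variable with values in `{0, …, d}`. -/
theorem mgf_le_exp_of_ae_le {Ω : Type*} [MeasurableSpace Ω] {μ : Measure Ω}
    [IsProbabilityMeasure μ] {X : Ω → ℕ} {d : ℕ} (hX : Measurable X) (hd : ∀ᵐ ω ∂μ, X ω ≤ d)
    {t : ℝ} (ht : 0 ≤ t) (htd : t * d ≤ 1) :
    mgf (fun ω => (X ω : ℝ)) μ t ≤ Real.exp ((∫ ω, (X ω : ℝ) ∂μ) * t * (1 + d * t)) := by
  have hint : Integrable (fun ω => (X ω : ℝ)) μ :=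
    memLp_one_iff_integrable.1 (memLp_natCast_of_ae_le hX hd 1)
  calc mgf (fun ω => (X ω : ℝ)) μ t ≤ ∫ ω, (1 + (X ω : ℝ) * (t * (1 + d * t))) ∂μ := by
        refine integral_mono_of_nonneg (ae_of_all _ fun ω => (Real.exp_pos _).le)
          ((integrable_const _).add (hint.mul_const _)) ?_
        filter_upwards [hd] with ω hω
        have hω' : (X ω : ℝ) ≤ d := by exact_mod_cast hω
        have hX0 : (0 : ℝ) ≤ X ω := Nat.cast_nonneg _
        have h0 : 0 ≤ t * X ω := mul_nonneg ht hX0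
        have h1 : t * X ω ≤ 1 := (mul_le_mul_of_nonneg_left hω' ht).trans htd
        -- `exp y ≤ 1 + y + y ^ 2` for `|y| ≤ 1`; one factor of `y ^ 2` is then bounded by `t d`,
        -- leaving a bound linear in `X`.
        have h2 := (abs_le.1 (Real.abs_exp_sub_one_sub_id_le (abs_le.2 ⟨by linarith, h1⟩))).2
        have h3 : (t * X ω) * (t * X ω) ≤ (t * X ω) * (t * d) := by gcongr
        have h4 : Real.exp (t * X ω) ≤ 1 + (X ω : ℝ) * (t * (1 + d * t)) := by nlinarith
        exact h4
    _ = 1 + (∫ ω, (X ω : ℝ) ∂μ) * t * (1 + d * t) := by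
        rw [integral_add (integrable_const _) (hint.mul_const _), integral_mul_const]
        simp [mul_assoc]
    _ ≤ _ := by rw [add_comm]; exact Real.add_one_le_exp _

theorem iIndepFun_natCast_generation {Ω : Type*} [MeasurableSpace Ω] {μ : Measure Ω}
    {ξ : ℕ → ℕ → Ω → ℕ} (hind : iIndepFun (fun q : ℕ × ℕ => ξ q.1 q.2) μ) (n : ℕ) :
    iIndepFun (fun i ω => (ξ n i ω : ℝ)) μ :=
  (hind.precomp (g := fun i : ℕ => (n, i)) fun _ _ h => (Prod.ext_iff.1 h).2).comp
    (fun _ (k : ℕ) => (k : ℝ)) fun _ => measurable_from_nat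

theorem lintegral_exp_sum_le {Ω : Type*} [MeasurableSpace Ω] {μ : Measure Ω}
    [IsProbabilityMeasure μ] {ξ : ℕ → ℕ → Ω → ℕ} {d : ℕ} {m t : ℝ}
    (hξ : ∀ n i, Measurable (ξ n i)) (hind : iIndepFun (fun q : ℕ × ℕ => ξ q.1 q.2) μ)
    (hd : ∀ n i, ∀ᵐ ω ∂μ, ξ n i ω ≤ d) (hm : ∀ n i, ∫ ω, (ξ n i ω : ℝ) ∂μ = m)
    (ht : 0 ≤ t) (htd : t * d ≤ 1) (n k : ℕ) :
    ∫⁻ ω, ENNReal.ofReal (Real.exp (t * ((∑ i ∈ Finset.range k, ξ n i ω : ℕ) : ℝ))) ∂μ ≤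
      ENNReal.ofReal (Real.exp (m * t * (1 + d * t) * k)) := by
  have hcast : ∀ i, Measurable fun ω => (ξ n i ω : ℝ) := fun i => measurable_from_nat.comp (hξ n i)
  have hint : ∀ i, Integrable (fun ω => Real.exp (t * (ξ n i ω : ℝ))) μ := fun i => by
    refine Integrable.of_bound ((hcast i).const_mul t).exp.aestronglyMeasurable (Real.exp (t * d)) ?_
    filter_upwards [hd n i] with ω hω
    rw [Real.norm_eq_abs, Real.abs_exp]
    gcongr
  have hind' := iIndepFun_natCast_generation hind n
  have hsum := hind'.integrable_exp_mul_sum (t := t) (s := Finset.range k) hcast fun i _ => hint i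
  have hmgf := hind'.mgf_sum (t := t) hcast (Finset.range k)
  simp only [mgf, Finset.sum_apply] at hsum hmgf
  simp only [Nat.cast_sum]
  rw [← ofReal_integral_eq_lintegral_ofReal hsum (ae_of_all _ fun ω => (Real.exp_pos _).le), hmgf]
  refine ENNReal.ofReal_le_ofReal ?_
  calc ∏ i ∈ Finset.range k, ∫ ω, Real.exp (t * (ξ n i ω : ℝ)) ∂μ
      ≤ ∏ _i ∈ Finset.range k, Real.exp (m * t * (1 + d * t)) := by
        refine Finset.prod_le_prod (fun i _ => integral_nonneg fun ω => (Real.exp_pos _).le)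
          fun i _ => ?_
        have h := mgf_le_exp_of_ae_le (hξ n i) (hd n i) ht htd
        rwa [hm n i] at h
    _ = Real.exp (m * t * (1 + d * t) * k) := by
        rw [Finset.prod_const, Finset.card_range, ← Real.exp_nat_mul, mul_comm]

/-- The substitution `r ↦ r / (1 - A r)` with `A = d / (m - 1)` dominates the one-step recursion
`t ↦ m t (1 + d t)` by multiplication by `m`. -/
theorem mobius_step_le {m d r : ℝ} (hm : 1 < m) (hr : 0 ≤ r)
    (hsmall : d / (m - 1) * (m * r) < 1) (hd : 0 ≤ d) :
    m * (r / (1 - d / (m - 1) * r)) * (1 + d * (r / (1 - d / (m - 1) * r))) ≤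
      m * r / (1 - d / (m - 1) * (m * r)) := by
  have hm1 : 0 < m - 1 := sub_pos.2 hm
  obtain ⟨A, hA⟩ : ∃ A, A = d / (m - 1) := ⟨_, rfl⟩
  have hdA : d = A * (m - 1) := by rw [hA]; field_simp
  have hA0 : 0 ≤ A := hA ▸ div_nonneg hd hm1.le
  rw [← hA] at hsmall ⊢
  have hAr : A * r ≤ A * (m * r) := by
    have := mul_nonneg hA0 (mul_nonneg hm1.le hr)
    linarith
  have h1 : 0 < 1 - A * r := by linarith
  have h2 : 0 < 1 - A * (m * r) := by linarith
  have h3 : m * (r / (1 - A * r)) * (1 + d * (r / (1 - A * r))) =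
      m * r * (1 - A * r + d * r) / (1 - A * r) ^ 2 := by
    have h1' := h1.ne'
    generalize 1 - A * r = y at h1' ⊢
    field_simp
  rw [h3, div_le_div_iff₀ (by positivity) h2, mul_assoc (m * r)]
  refine mul_le_mul_of_nonneg_left ?_ (mul_nonneg (by linarith) hr)
  -- With `u = A r` and `v = u (m - 1)`, the claim reads `(1 - u + v) (1 - u - v) ≤ (1 - u) ^ 2`;
  -- the gap is exactly `v ^ 2`.
  rw [hdA]
  nlinarith [sq_nonneg (A * r * (m - 1))]

/-- Uniform exponential moments of the normalized Galton–Watson process. -/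
theorem lintegral_exp_gwSize_le {Ω : Type*} [MeasurableSpace Ω] {μ : Measure Ω}
    [IsProbabilityMeasure μ] {ξ : ℕ → ℕ → Ω → ℕ} {d : ℕ} {m : ℝ} (hm1 : 1 < m)
    (hξ : ∀ n i, Measurable (ξ n i)) (hind : iIndepFun (fun q : ℕ × ℕ => ξ q.1 q.2) μ)
    (hd : ∀ n i, ∀ᵐ ω ∂μ, ξ n i ω ≤ d) (hm : ∀ n i, ∫ ω, (ξ n i ω : ℝ) ∂μ = m)
    (n : ℕ) {r : ℝ} (hr : 0 ≤ r) (hr1 : d / (m - 1) * (m ^ n * r) ≤ 1 / 2)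
    (hr2 : 2 * (m ^ n * r) * d ≤ 1) :
    ∫⁻ ω, ENNReal.ofReal (Real.exp (r / (1 - d / (m - 1) * r) * (gwSize ξ n ω : ℝ))) ∂μ ≤
      ENNReal.ofReal (Real.exp (m ^ n * r / (1 - d / (m - 1) * (m ^ n * r)))) := by
  induction n generalizing r with
  | zero => simp [gwSize]
  | succ n ih =>
    have hm0 : 0 < m := by linarith
    have hA : 0 ≤ d / (m - 1) := div_nonneg (Nat.cast_nonneg _) (by linarith)
    have hpow : 1 ≤ m ^ n := one_le_pow₀ hm1.le
    rw [show m ^ (n + 1) * r = m ^ n * (m * r) by ring] at hr1 hr2 ⊢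
    have hmr : r ≤ m * r := le_mul_of_one_le_left hr hm1.le
    have hpr : m * r ≤ m ^ n * (m * r) := le_mul_of_one_le_left (mul_nonneg hm0.le hr) hpow
    have hAmr : d / (m - 1) * (m * r) ≤ 1 / 2 := (mul_le_mul_of_nonneg_left hpr hA).trans hr1
    have hAr : d / (m - 1) * r ≤ 1 / 2 := (mul_le_mul_of_nonneg_left hmr hA).trans hAmr
    have ht0 : 0 ≤ r / (1 - d / (m - 1) * r) := div_nonneg hr (by linarith)
    have ht2 : r / (1 - d / (m - 1) * r) ≤ 2 * r := by
      rw [div_le_iff₀ (by linarith)]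
      nlinarith
    have htd : r / (1 - d / (m - 1) * r) * d ≤ 1 :=
      (mul_le_mul_of_nonneg_right (ht2.trans (by linarith)) (Nat.cast_nonneg d)).trans hr2
    refine le_trans ?_ (ih (mul_nonneg hm0.le hr) hr1 hr2)
    refine lintegral_gwSize_succ_le hξ hind n
      (fun _ j => ENNReal.ofReal (Real.exp (r / (1 - d / (m - 1) * r) * (j : ℝ))))
      (fun k => ENNReal.ofReal
        (Real.exp (m * r / (1 - d / (m - 1) * (m * r)) * (k : ℝ)))) fun k => ?_
    refine (lintegral_exp_sum_le hξ hind hd hm ht0 htd n k).trans ?_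
    gcongr
    exact mobius_step_le hm1 hr (by linarith) (Nat.cast_nonneg d)

/-! ### Almost sure convergence -/

theorem lintegral_gwSize_le {Ω : Type*} [MeasurableSpace Ω] {μ : Measure Ω}
    [IsProbabilityMeasure μ] {ξ : ℕ → ℕ → Ω → ℕ} {d : ℕ} {m : ℝ} (hm0 : 0 ≤ m)
    (hξ : ∀ n i, Measurable (ξ n i)) (hind : iIndepFun (fun q : ℕ × ℕ => ξ q.1 q.2) μ)
    (hd : ∀ n i, ∀ᵐ ω ∂μ, ξ n i ω ≤ d) (hm : ∀ n i, ∫ ω, (ξ n i ω : ℝ) ∂μ = m) (n : ℕ) :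
    ∫⁻ ω, ENNReal.ofReal (gwSize ξ n ω : ℝ) ∂μ ≤ ENNReal.ofReal (m ^ n) := by
  induction n with
  | zero => simp [gwSize]
  | succ n ih =>
    have hstep := lintegral_gwSize_succ_le hξ hind n (fun _ j => ENNReal.ofReal (j : ℝ))
      (fun k => ENNReal.ofReal m * ENNReal.ofReal (k : ℝ)) fun k => by
        have hint : ∀ i ∈ Finset.range k, Integrable (fun ω => (ξ n i ω : ℝ)) μ := fun i _ =>
          memLp_one_iff_integrable.1 (memLp_natCast_of_ae_le (hξ n i) (hd n i) 1)
        simp only [Nat.cast_sum]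
        rw [← ofReal_integral_eq_lintegral_ofReal (integrable_finsetSum _ hint)
          (ae_of_all _ fun ω => by positivity), integral_finsetSum _ hint]
        simp only [hm, Finset.sum_const, Finset.card_range, nsmul_eq_mul]
        rw [← ENNReal.ofReal_mul hm0, mul_comm]
    have hZ : Measurable fun ω => ENNReal.ofReal (gwSize ξ n ω : ℝ) :=
      (measurable_from_nat (f := fun k : ℕ => ENNReal.ofReal (k : ℝ))).comp
        (measurable_gwSize n fun k _ => hξ k)
    rw [lintegral_const_mul _ hZ] at hstep
    refine hstep.trans ?_
    rw [pow_succ', ENNReal.ofReal_mul hm0]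
    gcongr

/-- Given `k` individuals, the integral is the variance of a sum of `k` independent variables in
`[0, d]`, each of variance at most `(d / 2) ^ 2`. -/
theorem lintegral_sq_gwSize_sub_le {Ω : Type*} [MeasurableSpace Ω] {μ : Measure Ω}
    [IsProbabilityMeasure μ] {ξ : ℕ → ℕ → Ω → ℕ} {d : ℕ} {m : ℝ} (hm0 : 0 ≤ m)
    (hξ : ∀ n i, Measurable (ξ n i)) (hind : iIndepFun (fun q : ℕ × ℕ => ξ q.1 q.2) μ)
    (hd : ∀ n i, ∀ᵐ ω ∂μ, ξ n i ω ≤ d) (hm : ∀ n i, ∫ ω, (ξ n i ω : ℝ) ∂μ = m) (n : ℕ) :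
    ∫⁻ ω, ENNReal.ofReal (((gwSize ξ (n + 1) ω : ℝ) - m * gwSize ξ n ω) ^ 2) ∂μ ≤
      ENNReal.ofReal ((d / 2) ^ 2 * m ^ n) := by
  have hstep := lintegral_gwSize_succ_le hξ hind n
    (fun k j => ENNReal.ofReal (((j : ℝ) - m * k) ^ 2))
    (fun k => ENNReal.ofReal ((d / 2 : ℝ) ^ 2) * ENNReal.ofReal (k : ℝ)) fun k => by
      have hL : ∀ i ∈ Finset.range k, MemLp (fun ω => (ξ n i ω : ℝ)) 2 μ := fun i _ =>
        memLp_natCast_of_ae_le (hξ n i) (hd n i) 2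
      have hind' := iIndepFun_natCast_generation hind n
      have hvar := IndepFun.variance_sum hL fun i _ j _ hij => hind'.indepFun hij
      have hmean : ∫ ω, (∑ i ∈ Finset.range k, fun ω => (ξ n i ω : ℝ)) ω ∂μ = m * k := by
        simp only [Finset.sum_apply]
        rw [integral_finsetSum _ fun i hi => (hL i hi).integrable one_le_two]
        simp [hm, mul_comm]
      have hev := evariance_eq_lintegral_ofReal (∑ i ∈ Finset.range k, fun ω => (ξ n i ω : ℝ)) μ
      rw [hmean, ← ofReal_variance (memLp_finsetSum' _ hL), hvar] at hev
      simp only [Finset.sum_apply] at hev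
      simp only [Nat.cast_sum]
      rw [← hev, ← ENNReal.ofReal_mul (by positivity)]
      refine ENNReal.ofReal_le_ofReal ?_
      calc ∑ i ∈ Finset.range k, variance (fun ω => (ξ n i ω : ℝ)) μ
          ≤ ∑ _i ∈ Finset.range k, (d / 2 : ℝ) ^ 2 := by
            refine Finset.sum_le_sum fun i hi => ?_
            have h := variance_le_sq_of_bounded (μ := μ) (a := 0) (b := d)
              (X := fun ω => (ξ n i ω : ℝ)) (by
                filter_upwards [hd n i] with ω hω
                exact ⟨Nat.cast_nonneg _, by exact_mod_cast hω⟩) (hL i hi).aemeasurable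
            rwa [sub_zero] at h
        _ = (d / 2 : ℝ) ^ 2 * k := by simp [mul_comm]
  refine hstep.trans ?_
  have hZ : Measurable fun ω => ENNReal.ofReal (gwSize ξ n ω : ℝ) :=
    (measurable_from_nat (f := fun k : ℕ => ENNReal.ofReal (k : ℝ))).comp
      (measurable_gwSize n fun k _ => hξ k)
  rw [lintegral_const_mul _ hZ, ENNReal.ofReal_mul (by positivity)]
  gcongr
  exact lintegral_gwSize_le hm0 hξ hind hd hm n

theorem measurable_gwSize_div {Ω : Type*} [MeasurableSpace Ω] {ξ : ℕ → ℕ → Ω → ℕ}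
    (hξ : ∀ n i, Measurable (ξ n i)) (m : ℝ) (n : ℕ) :
    Measurable fun ω => (gwSize ξ n ω : ℝ) / m ^ n :=
  ((measurable_from_nat (f := fun k : ℕ => (k : ℝ))).comp
    (measurable_gwSize n fun k _ => hξ k)).div_const _

/-- A sequence whose squared increments are summable against a growing geometric weight
converges. -/
theorem exists_tendsto_of_summable_geometric_mul_sq {u : ℕ → ℝ} {b : ℝ} (hb : 1 < b)
    (hu : Summable fun n => b ^ n * (u (n + 1) - u n) ^ 2) : ∃ l, Tendsto u atTop (𝓝 l) := by
  have hb0 : 0 < b := by linarith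
  have hgeom : Summable fun n : ℕ => (b⁻¹) ^ n :=
    summable_geometric_of_lt_one (inv_nonneg.2 hb0.le) (inv_lt_one_of_one_lt₀ hb)
  refine cauchySeq_tendsto_of_complete (cauchySeq_of_summable_dist ?_)
  refine Summable.of_nonneg_of_le (fun _ => dist_nonneg) (fun n => ?_) (hgeom.add hu)
  rw [dist_comm, Real.dist_eq, inv_pow]
  have hp : 0 < b ^ n := pow_pos hb0 n
  rw [← sq_abs]
  generalize |u (n + 1) - u n| = y
  -- AM-GM: `2 y ≤ b ^ (-n) + b ^ n * y ^ 2`, and both terms are summable.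
  have h : 0 ≤ (b ^ n)⁻¹ * (1 - b ^ n * y) ^ 2 := by positivity
  have h2 : (b ^ n)⁻¹ * (1 - b ^ n * y) ^ 2 =
      (b ^ n)⁻¹ + b ^ n * y ^ 2 - 2 * y := by field_simp; ring
  have h3 : 0 ≤ (b ^ n)⁻¹ + b ^ n * y ^ 2 := by positivity
  linarith

/-- The weight `√m ^ n` spends half of the decay `m ^ (-n)`; the other half keeps the bound summable
when `m > 1`. -/
theorem lintegral_sq_increment_le {Ω : Type*} [MeasurableSpace Ω] {μ : Measure Ω}
    [IsProbabilityMeasure μ] {ξ : ℕ → ℕ → Ω → ℕ} {d : ℕ} {m : ℝ} (hm0 : 0 < m)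
    (hξ : ∀ n i, Measurable (ξ n i)) (hind : iIndepFun (fun q : ℕ × ℕ => ξ q.1 q.2) μ)
    (hd : ∀ n i, ∀ᵐ ω ∂μ, ξ n i ω ≤ d) (hm : ∀ n i, ∫ ω, (ξ n i ω : ℝ) ∂μ = m) (n : ℕ) :
    ∫⁻ ω, ENNReal.ofReal (√m ^ n *
        ((gwSize ξ (n + 1) ω : ℝ) / m ^ (n + 1) - (gwSize ξ n ω : ℝ) / m ^ n) ^ 2) ∂μ ≤
      ENNReal.ofReal ((d / 2 / m) ^ 2 * ((√m)⁻¹) ^ n) := by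
  have hscale : ∀ a b : ℝ, √m ^ n * (a / m ^ (n + 1) - b / m ^ n) ^ 2 =
      √m ^ n / (m ^ (n + 1)) ^ 2 * (a - m * b) ^ 2 := fun a b => by
    have h : a / m ^ (n + 1) - b / m ^ n = (a - m * b) / m ^ (n + 1) := by
      rw [pow_succ]
      field_simp
    rw [h]
    ring
  have hc : 0 ≤ √m ^ n / (m ^ (n + 1)) ^ 2 := by positivity
  simp only [hscale, ENNReal.ofReal_mul hc]
  rw [lintegral_const_mul' _ _ ENNReal.ofReal_ne_top]
  refine (mul_le_mul_right (lintegral_sq_gwSize_sub_le hm0.le hξ hind hd hm n) _).trans_eq ?_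
  rw [← ENNReal.ofReal_mul hc]
  congr 1
  have hb0 : √m ^ n ≠ 0 := pow_ne_zero _ (Real.sqrt_pos.2 hm0).ne'
  have hsq : m ^ n = √m ^ n * √m ^ n := by rw [← mul_pow, Real.mul_self_sqrt hm0.le]
  rw [inv_pow, pow_succ m n, hsq]
  generalize √m ^ n = y at hb0 ⊢
  field_simp

theorem ae_tendsto_gwNormalized {Ω : Type*} [MeasurableSpace Ω] {μ : Measure Ω}
    [IsProbabilityMeasure μ] {ξ : ℕ → ℕ → Ω → ℕ} {d : ℕ} {m : ℝ} (hm1 : 1 < m)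
    (hξ : ∀ n i, Measurable (ξ n i)) (hind : iIndepFun (fun q : ℕ × ℕ => ξ q.1 q.2) μ)
    (hd : ∀ n i, ∀ᵐ ω ∂μ, ξ n i ω ≤ d) (hm : ∀ n i, ∫ ω, (ξ n i ω : ℝ) ∂μ = m) :
    ∀ᵐ ω ∂μ, Tendsto (fun n : ℕ => gwNormalized m ξ (n : ℕ∞) ω) atTop
      (𝓝 (gwNormalized m ξ ⊤ ω)) := by
  have hm0 : 0 < m := by linarith
  have hb : 1 < √m := by rwa [Real.lt_sqrt zero_le_one, one_pow]
  have hb0 : 0 < √m := by linarith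
  obtain ⟨D, hD⟩ : ∃ D : ℕ → Ω → ℝ, ∀ n ω, D n ω = √m ^ n *
      ((gwSize ξ (n + 1) ω : ℝ) / m ^ (n + 1) - (gwSize ξ n ω : ℝ) / m ^ n) ^ 2 :=
    ⟨_, fun _ _ => rfl⟩
  have hD0 : ∀ n ω, 0 ≤ D n ω := fun n ω => by rw [hD]; positivity
  have hDm : ∀ n, Measurable fun ω => ENNReal.ofReal (D n ω) := fun n => by
    simp only [hD]
    exact ((((measurable_gwSize_div hξ m (n + 1)).sub
      (measurable_gwSize_div hξ m n)).pow_const 2).const_mul _).ennreal_ofReal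
  have hbound : ∀ n, ∫⁻ ω, ENNReal.ofReal (D n ω) ∂μ ≤
      ENNReal.ofReal ((d / 2 / m) ^ 2 * ((√m)⁻¹) ^ n) := fun n => by
    simp only [hD]
    exact lintegral_sq_increment_le hm0 hξ hind hd hm n
  have hsum : ∫⁻ ω, ∑' n, ENNReal.ofReal (D n ω) ∂μ ≠ ⊤ := by
    rw [lintegral_tsum fun n => (hDm n).aemeasurable]
    refine ne_top_of_le_ne_top ?_ (ENNReal.tsum_le_tsum hbound)
    have hs : Summable fun n : ℕ => (d / 2 / m) ^ 2 * ((√m)⁻¹) ^ n :=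
      (summable_geometric_of_lt_one (inv_nonneg.2 hb0.le) (inv_lt_one_of_one_lt₀ hb)).mul_left _
    rw [← ENNReal.ofReal_tsum_of_nonneg (fun n => by positivity) hs]
    exact ENNReal.ofReal_ne_top
  filter_upwards [ae_lt_top (Measurable.tsum hDm) hsum]
    with ω hω
  have hsω : Summable fun n => √m ^ n * ((gwSize ξ (n + 1) ω : ℝ) / m ^ (n + 1) -
      (gwSize ξ n ω : ℝ) / m ^ n) ^ 2 := by
    refine (ENNReal.summable_toReal hω.ne).congr fun n => ?_
    rw [ENNReal.toReal_ofReal (hD0 n ω), hD]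
  simp only [gwNormalized_coe, gwNormalized_top]
  exact tendsto_nhds_limUnder (exists_tendsto_of_summable_geometric_mul_sq
    (u := fun n => (gwSize ξ n ω : ℝ) / m ^ n) hb hsω)

/-! ### Tail bounds, including the limit -/

theorem measureReal_ge_le_of_lintegral_exp_le {Ω : Type*} [MeasurableSpace Ω] {μ : Measure Ω}
    {X : Ω → ℝ} (hX : AEMeasurable X μ) {s C : ℝ} (hs : 0 ≤ s) (hC : 0 ≤ C)
    (h : ∫⁻ ω, ENNReal.ofReal (Real.exp (s * X ω)) ∂μ ≤ ENNReal.ofReal C) (x : ℝ) :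
    μ.real {ω | x ≤ X ω} ≤ C * Real.exp (-(s * x)) := by
  have hmarkov := (mul_meas_ge_le_lintegral₀ (μ := μ) (hX.const_mul s).exp.ennreal_ofReal
    (ENNReal.ofReal (Real.exp (s * x)))).trans h
  have hsub : {ω | x ≤ X ω} ⊆
      {ω | ENNReal.ofReal (Real.exp (s * x)) ≤ ENNReal.ofReal (Real.exp (s * X ω))} := by
    intro ω (hω : x ≤ X ω)
    exact ENNReal.ofReal_le_ofReal (Real.exp_le_exp.2 (mul_le_mul_of_nonneg_left hω hs))
  have h1 := (mul_le_mul_right (measure_mono (μ := μ) hsub) _).trans hmarkov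
  have h2 := ENNReal.toReal_mono ENNReal.ofReal_ne_top h1
  rw [ENNReal.toReal_mul, ENNReal.toReal_ofReal (Real.exp_pos _).le, ENNReal.toReal_ofReal hC] at h2
  rw [Real.exp_neg, ← div_eq_mul_inv, le_div_iff₀ (Real.exp_pos _), mul_comm]
  exact h2

theorem lintegral_exp_gwNormalized_le {Ω : Type*} [MeasurableSpace Ω] {μ : Measure Ω}
    [IsProbabilityMeasure μ] {ξ : ℕ → ℕ → Ω → ℕ} {d : ℕ} {m : ℝ} (hm1 : 1 < m)
    (hξ : ∀ n i, Measurable (ξ n i)) (hind : iIndepFun (fun q : ℕ × ℕ => ξ q.1 q.2) μ)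
    (hd : ∀ n i, ∀ᵐ ω ∂μ, ξ n i ω ≤ d) (hm : ∀ n i, ∫ ω, (ξ n i ω : ℝ) ∂μ = m)
    {s : ℝ} (hs : 0 ≤ s) (hs1 : d / (m - 1) * s ≤ 1 / 2) (hs2 : 2 * s * d ≤ 1) (n : ℕ∞) :
    ∫⁻ ω, ENNReal.ofReal (Real.exp (s * gwNormalized m ξ n ω)) ∂μ ≤
      ENNReal.ofReal (Real.exp (2 * s)) := by
  have hm0 : 0 < m := by linarith
  have hfin : ∀ n : ℕ, ∫⁻ ω, ENNReal.ofReal (Real.exp (s * gwNormalized m ξ (n : ℕ∞) ω)) ∂μ ≤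
      ENNReal.ofReal (Real.exp (2 * s)) := fun n => by
    have hr : 0 ≤ s / m ^ n := by positivity
    have hmr : m ^ n * (s / m ^ n) = s := by field_simp
    have hrs : s / m ^ n ≤ s := div_le_self hs (one_le_pow₀ hm1.le)
    have hA : 0 ≤ d / (m - 1) := div_nonneg (Nat.cast_nonneg _) (by linarith)
    have h := lintegral_exp_gwSize_le hm1 hξ hind hd hm n hr (by rwa [hmr]) (by rwa [hmr])
    rw [hmr] at h
    refine (lintegral_mono fun ω => ?_).trans (h.trans ?_)
    · refine ENNReal.ofReal_le_ofReal (Real.exp_le_exp.2 ?_)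
      rw [gwNormalized_coe, ← mul_div_assoc, mul_div_right_comm]
      refine mul_le_mul_of_nonneg_right ?_ (Nat.cast_nonneg _)
      -- Since `r ≤ r / (1 - A r)` for `r = s / m ^ n`, the exponent `s W n = r Z n` is covered.
      have h0 : 0 ≤ d / (m - 1) * (s / m ^ n) := mul_nonneg hA hr
      have h1 := mul_le_mul_of_nonneg_left hrs hA
      exact le_div_self hr (by linarith) (by linarith)
    · refine ENNReal.ofReal_le_ofReal (Real.exp_le_exp.2 ?_)
      rw [div_le_iff₀ (by linarith)]
      nlinarith
  induction n using ENat.recTopCoe with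
  | coe n => exact hfin n
  | top =>
    have hlim := ae_tendsto_gwNormalized hm1 hξ hind hd hm
    have hmeas : ∀ n : ℕ, Measurable fun ω =>
        ENNReal.ofReal (Real.exp (s * gwNormalized m ξ (n : ℕ∞) ω)) := fun n =>
      ((measurable_gwSize_div hξ m n).const_mul s).exp.ennreal_ofReal
    calc ∫⁻ ω, ENNReal.ofReal (Real.exp (s * gwNormalized m ξ ⊤ ω)) ∂μ
        = ∫⁻ ω, liminf (fun n : ℕ =>
            ENNReal.ofReal (Real.exp (s * gwNormalized m ξ (n : ℕ∞) ω))) atTop ∂μ := by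
          refine lintegral_congr_ae ?_
          filter_upwards [hlim] with ω hω
          have hc : Continuous fun y : ℝ => ENNReal.ofReal (Real.exp (s * y)) :=
            ENNReal.continuous_ofReal.comp (by fun_prop)
          exact ((hc.tendsto _).comp hω).liminf_eq.symm
      _ ≤ liminf (fun n : ℕ => ∫⁻ ω,
            ENNReal.ofReal (Real.exp (s * gwNormalized m ξ (n : ℕ∞) ω)) ∂μ) atTop :=
          lintegral_liminf_le hmeas
      _ ≤ liminf (fun _ : ℕ => ENNReal.ofReal (Real.exp (2 * s))) atTop :=
          liminf_le_liminf (Eventually.of_forall hfin)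
      _ = ENNReal.ofReal (Real.exp (2 * s)) := liminf_const _

theorem aemeasurable_gwNormalized {Ω : Type*} [MeasurableSpace Ω] {μ : Measure Ω}
    {ξ : ℕ → ℕ → Ω → ℕ} {m : ℝ} (hξ : ∀ n i, Measurable (ξ n i))
    (hlim : ∀ᵐ ω ∂μ, Tendsto (fun n : ℕ => gwNormalized m ξ (n : ℕ∞) ω) atTop
      (𝓝 (gwNormalized m ξ ⊤ ω))) (n : ℕ∞) : AEMeasurable (gwNormalized m ξ n) μ := by
  have hfin : ∀ n : ℕ, AEMeasurable (gwNormalized m ξ (n : ℕ∞)) μ := fun n =>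
    (measurable_gwSize_div hξ m n).aemeasurable
  induction n using ENat.recTopCoe with
  | coe n => exact hfin n
  | top => exact aemeasurable_of_tendsto_metrizable_ae' hfin hlim

theorem theorem1 :
    ∃ c₁ c₂ : ℝ, 0 < c₁ ∧ 0 < c₂ ∧ c₁ = 2 ∧ c₂ = (Real.log 3 - 1) / 40 ∧
      ∀ (m : ℝ) (d : ℕ) (p : PMF ℕ), 1 < m → 2 ≤ d →
        (∀ k ∈ p.support, k ≤ d) → (∫ k, (k : ℝ) ∂p.toMeasure) = m →
        ∀ {Ω : Type*} [MeasurableSpace Ω] (μ : Measure Ω) [IsProbabilityMeasure μ]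
          (ξ : ℕ → ℕ → Ω → ℕ),
          (∀ n i, Measurable (ξ n i)) →
          (∀ n i, μ.map (ξ n i) = p.toMeasure) →
          iIndepFun (fun q : ℕ × ℕ => ξ q.1 q.2) μ →
          (∀ᵐ ω ∂μ, Tendsto (fun n : ℕ => gwNormalized m ξ (n : ℕ∞) ω) atTop
              (𝓝 (gwNormalized m ξ ⊤ ω))) ∧
            ∀ (n : ℕ∞) (x : ℝ), 0 ≤ x →
              μ.real {ω | x ≤ gwNormalized m ξ n ω} ≤
                c₁ * Real.exp (-c₂ * ((m - 1) / m) * (x / d)) := by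
  have hlog1 : 1 < Real.log 3 :=
    (Real.lt_log_iff_exp_lt (by norm_num)).2 (Real.exp_one_lt_d9.trans (by norm_num))
  have hlog2 : Real.log 3 ≤ 2 :=
    (Real.log_le_sub_one_of_pos (by norm_num)).trans (by norm_num)
  refine ⟨2, (Real.log 3 - 1) / 40, by norm_num, by linarith, rfl, rfl, ?_⟩
  intro m d p hm1 hd2 hsupp hmean Ω _ μ _ ξ hξ hlaw hind
  obtain ⟨c, hc⟩ : ∃ c, c = (Real.log 3 - 1) / 40 := ⟨_, rfl⟩
  have hc0 : 0 < c := by linarith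
  -- From here on, only `0 < c ≤ 1 / 40` is used about `c`.
  have hc1 : c ≤ 1 / 40 := by linarith
  rw [← hc]
  have hd : ∀ n i, ∀ᵐ ω ∂μ, ξ n i ω ≤ d := fun n i => by
    have hp : ∀ᵐ k ∂p.toMeasure, k ≤ d := by
      rw [ae_iff, p.toMeasure_apply_eq_zero_iff (MeasurableSet.of_discrete)]
      exact Set.disjoint_left.2 fun k hk hk' => hk' (hsupp k hk)
    rw [← hlaw n i] at hp
    exact ae_of_ae_map (hξ n i).aemeasurable hp
  have hm : ∀ n i, ∫ ω, (ξ n i ω : ℝ) ∂μ = m := fun n i => by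
    rw [← hmean, ← hlaw n i, integral_map (hξ n i).aemeasurable
      measurable_from_nat.aestronglyMeasurable]
  have hlim := ae_tendsto_gwNormalized hm1 hξ hind hd hm
  refine ⟨hlim, fun n x hx => ?_⟩
  have hm0 : 0 < m := by linarith
  have hm1' : 0 < m - 1 := by linarith
  have hd2' : (2 : ℝ) ≤ d := by exact_mod_cast hd2
  have hd0 : (0 : ℝ) < d := by linarith
  have hq : (m - 1) / m ≤ 1 := (div_le_one hm0).2 (by linarith)
  have hq0 : 0 < (m - 1) / m := div_pos hm1' hm0
  have hcq : c * ((m - 1) / m) ≤ 1 / 40 := (mul_le_of_le_one_right hc0.le hq).trans hc1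
  have hs : 0 ≤ c * ((m - 1) / m) / d := by positivity
  have hsd : c * ((m - 1) / m) / d * d = c * ((m - 1) / m) := by field_simp
  -- The factor `(m - 1) / (m d)` in `s` cancels the blow-up of `A = d / (m - 1)` near `m = 1`: `A s
  -- = c / m`.
  have hs1 : d / (m - 1) * (c * ((m - 1) / m) / d) ≤ 1 / 2 := by
    have h : d / (m - 1) * (c * ((m - 1) / m) / d) = c / m := by field_simp
    rw [h, div_le_iff₀ hm0]
    linarith
  have hsle : c * ((m - 1) / m) / d ≤ 1 / 40 := (div_le_self (by positivity) (by linarith)).trans hcq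
  -- The prefactor `c₁ = 2` arises here: `2 s ≤ 1 / 20 < log 2`.
  have hexp2 : Real.exp (2 * (c * ((m - 1) / m) / d)) ≤ 2 := by
    rw [← Real.le_log_iff_exp_le two_pos]
    linarith [Real.log_two_gt_d9]
  have hmom := (lintegral_exp_gwNormalized_le hm1 hξ hind hd hm hs hs1
    (by rw [mul_assoc, hsd]; linarith) n).trans (ENNReal.ofReal_le_ofReal hexp2)
  have h := measureReal_ge_le_of_lintegral_exp_le (aemeasurable_gwNormalized hξ hlim n) hs
    zero_le_two hmom x
  have hexponent : -c * ((m - 1) / m) * (x / d) = -(c * ((m - 1) / m) / d * x) := by ring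
  rwa [hexponent]
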